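/- Let $X$ be a real Hilbert space with (norm) dual $X^*$, and let $C\subset X$ be an unbounded closed convex set. Let $\sigma_C(x^*)=\sup_{c\in C}\langle x^*,c\rangle\in[-\infty,+\infty]$ be the support function of $C$ and let $\operatorname{bar}(C)=\{x^*\in X^*: \sigma_C(x^*)<+\infty\}$ be its barrier cone; interiors are taken in the norm topologies of $X$ and $X^*$. Assume that at least one of the following conditions holds: (A) $X$ is reflexive (which is automatic for a Hilbert space) and $\operatorname{Int}\operatorname{bar}(C)\neq\emptyset$; (C) there are $r>0$ and a finite-dimensional linear subspace $Z\subset X$ with $C\subset B(0;r)+Z$, where $B(0;r)$ is the open ball of radius $r$ around $0$. We say that $C$ has the strong separation property if for every nonempty closed convex set $D\subset X$ with $C\cap D=\emptyset$ there is $x^*\in X^*\setminus\{0\}$ such that $$\sup_{c\in C}\langle x^*,c\rangle<\inf_{d\in D}\langle x^*,d\rangle .$$ Then $C$ has the strong separation property if and only if $\operatorname{Int} C\neq\emptyset$ and $\operatorname{bar}(C)=\operatorname{Int}\operatorname{bar}(C)\cup\{0\}$. -/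

import Mathlib

open scoped Pointwise

namespace BarrierSeparation

variable {X : Type*} [NormedAddCommGroup X] [NormedSpace ℝ X]

/-- `C` and `D` are strongly separated: some nonzero continuous linear functional `f` satisfies
`sup_{c ∈ C} f c < inf_{d ∈ D} f d` (supremum and infimum in the extended reals). -/
def StronglySeparated (C D : Set X) : Prop :=
  ∃ f : StrongDual ℝ X, f ≠ 0 ∧ (⨆ c ∈ C, ((f c : ℝ) : EReal)) < ⨅ d ∈ D, ((f d : ℝ) : EReal)

/-- `C` can be strongly separated from every nonempty closed convex set disjoint from it. -/
def HasStrongSeparationProperty (C : Set X) : Prop :=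
  ∀ D : Set X, D.Nonempty → IsClosed D → Convex ℝ D → Disjoint C D → StronglySeparated C D

/-- The support function of `C`, with values in the extended reals. -/
noncomputable def supportFunction (C : Set X) (f : StrongDual ℝ X) : EReal :=
  ⨆ c ∈ C, ((f c : ℝ) : EReal)

/-- The barrier cone of `C`: the functionals at which the support function is not `+∞`. -/
def barrierCone (C : Set X) : Set (StrongDual ℝ X) :=
  {f | supportFunction C f < ⊤}

variable (X) in
/-- The space is reflexive: the canonical embedding into the bidual is onto. -/
def IsReflexiveSpace : Prop :=
  Function.Surjective (NormedSpace.inclusionInDoubleDual ℝ X)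

/-- Condition (A): the space is reflexive and the barrier cone of `C` has an interior point
for the dual norm. -/
def ConditionA (C : Set X) : Prop :=
  IsReflexiveSpace X ∧ (interior (barrierCone C)).Nonempty

/-- Condition (C): `C` lies in `B(0; r) + Z` for some `r > 0` and some finite-dimensional
linear subspace `Z`. -/
def ConditionC (C : Set X) : Prop :=
  ∃ r : ℝ, 0 < r ∧ ∃ Z : Submodule ℝ X, FiniteDimensional ℝ Z ∧
    C ⊆ Metric.ball (0 : X) r + (Z : Set X)

end BarrierSeparation

open Filter Topology

namespace BarrierSeparation

/-! For convex sets, strong separation amounts to positive distance. Under (A) or (C), normalised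
unbounded sequences in `C` have nonzero weak limits along an ultrafilter, so unbounded closed convex
subsets of `C` recede in some direction `u ≠ 0`.

Necessity: if `C` contains a ray along `u` that `v` leaves at once
(`not_hasStrongSeparationProperty_of_ray`), a hyperbolic region in the `u`, `v` plane is disjoint
from `C` but at distance zero. Baire supplies such a `v` when `C` has empty interior. A nonzero `f`
in the barrier cone attains its maximum, since otherwise its supporting hyperplane defeats
separation; an unbounded slice near the maximum would give a ray with `f u = 0`, left along any `v`
with `f v = 1`. So the slice is bounded and `f` is interior.

Sufficiency: Hahn–Banach gives a weakly separating `f`, interior by assumption. It decays linearly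
on `C`, so pairs in `C` and `D` with distance tending to zero are bounded and share a weak limit in
`C ∩ D`. -/

theorem exists_seq_tendsto_norm_of_not_isBounded {X : Type*}
    [SeminormedAddCommGroup X] {S : Set X} (hS : ¬ Bornology.IsBounded S) :
    ∃ x : ℕ → X, (∀ n, x n ∈ S) ∧ Tendsto (fun n => ‖x n‖) atTop atTop := by
  have : ∀ n : ℕ, ∃ x ∈ S, (n : ℝ) ≤ ‖x‖ := by
    intro n
    by_contra! hn
    exact hS (isBounded_iff_forall_norm_le.2 ⟨n, fun x hx => (hn x hx).le⟩)
  choose x hx hn using this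
  exact ⟨x, hx, tendsto_atTop_mono hn tendsto_natCast_atTop_atTop⟩

section Normed

variable {X : Type*} [NormedAddCommGroup X] [NormedSpace ℝ X]

/-! ### Strong separation as positive distance -/

theorem stronglySeparated_iff {C D : Set X} :
    StronglySeparated C D ↔ ∃ f : StrongDual ℝ X, f ≠ 0 ∧ ∃ r s : ℝ, r < s ∧
      (∀ c ∈ C, f c ≤ r) ∧ ∀ d ∈ D, s ≤ f d := by
  constructor
  · rintro ⟨f, hf, h⟩
    obtain ⟨r, hr, hr'⟩ := EReal.lt_iff_exists_real_btwn.1 h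
    obtain ⟨s, hs, hs'⟩ := EReal.lt_iff_exists_real_btwn.1 hr'
    refine ⟨f, hf, r, s, EReal.coe_lt_coe_iff.1 hs, fun c hc => ?_, fun d hd => ?_⟩
    · exact EReal.coe_le_coe_iff.1
        ((le_iSup₂ (f := fun c (_ : c ∈ C) => ((f c : ℝ) : EReal)) c hc).trans hr.le)
    · exact EReal.coe_le_coe_iff.1
        (hs'.le.trans (iInf₂_le (f := fun d (_ : d ∈ D) => ((f d : ℝ) : EReal)) d hd))
  · rintro ⟨f, hf, r, s, hrs, hC, hD⟩
    refine ⟨f, hf, ?_⟩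
    calc (⨆ c ∈ C, ((f c : ℝ) : EReal)) ≤ (r : EReal) :=
          iSup₂_le fun c hc => EReal.coe_le_coe_iff.2 (hC c hc)
      _ < (s : EReal) := EReal.coe_lt_coe_iff.2 hrs
      _ ≤ _ := le_iInf₂ fun d hd => EReal.coe_le_coe_iff.2 (hD d hd)

theorem mem_barrierCone_iff {C : Set X} {f : StrongDual ℝ X} :
    f ∈ barrierCone C ↔ ∃ r : ℝ, ∀ c ∈ C, f c ≤ r := by
  constructor
  · intro h
    obtain ⟨r, hr, -⟩ := EReal.lt_iff_exists_real_btwn.1 h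
    exact ⟨r, fun c hc => EReal.coe_le_coe_iff.1
      ((le_iSup₂ (f := fun c (_ : c ∈ C) => ((f c : ℝ) : EReal)) c hc).trans hr.le)⟩
  · rintro ⟨r, hr⟩
    exact (iSup₂_le fun c hc => EReal.coe_le_coe_iff.2 (hr c hc)).trans_lt (EReal.coe_lt_top r)

theorem zero_mem_barrierCone (C : Set X) : (0 : StrongDual ℝ X) ∈ barrierCone C :=
  mem_barrierCone_iff.2 ⟨0, fun _ _ => le_rfl⟩

theorem StronglySeparated.exists_pos_le_norm_sub {C D : Set X} (h : StronglySeparated C D) :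
    ∃ ε > 0, ∀ c ∈ C, ∀ d ∈ D, ε ≤ ‖d - c‖ := by
  obtain ⟨f, hf, r, s, hrs, hC, hD⟩ := stronglySeparated_iff.1 h
  have hpos : 0 < ‖f‖ := norm_pos_iff.2 hf
  refine ⟨(s - r) / ‖f‖, div_pos (by linarith) hpos, fun c hc d hd => ?_⟩
  rw [div_le_iff₀ hpos]
  have h1 := (le_abs_self _).trans (f.le_opNorm (d - c))
  rw [map_sub] at h1
  linarith [hC c hc, hD d hd]

/-- Hahn–Banach separates `0` from the closure of `D - C`, which leaves a uniform gap `u`. -/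
theorem stronglySeparated_of_pos_le_norm_sub {C D : Set X} (hC : Convex ℝ C) (hD : Convex ℝ D)
    (hCne : C.Nonempty) (hDne : D.Nonempty) {ε : ℝ} (hε : 0 < ε)
    (h : ∀ c ∈ C, ∀ d ∈ D, ε ≤ ‖d - c‖) : StronglySeparated C D := by
  have h0 : (0 : X) ∉ closure (D - C) := by
    intro h0
    obtain ⟨x, hx, hlt⟩ := Metric.mem_closure_iff.1 h0 ε hε
    obtain ⟨d, hd, c, hc, rfl⟩ := Set.mem_sub.1 hx
    rw [dist_zero_left] at hlt
    exact absurd (h c hc d hd) (not_le.2 hlt)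
  obtain ⟨f, u, hu, hf⟩ := geometric_hahn_banach_point_closed
    (hD.sub hC).closure isClosed_closure h0
  rw [map_zero] at hu
  have hgap : ∀ c ∈ C, ∀ d ∈ D, f c + u < f d := fun c hc d hd => by
    have := hf _ (subset_closure (Set.sub_mem_sub hd hc))
    rw [map_sub] at this
    linarith
  obtain ⟨c₀, hc₀⟩ := hCne
  obtain ⟨d₀, hd₀⟩ := hDne
  have hbdd : BddAbove (f '' C) := ⟨f d₀, by
    rintro _ ⟨c, hc, rfl⟩
    linarith [hgap c hc d₀ hd₀]⟩
  refine stronglySeparated_iff.2 ⟨f, ?_, sSup (f '' C), sSup (f '' C) + u, by linarith,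
    fun c hc => le_csSup hbdd ⟨c, hc, rfl⟩, fun d hd => ?_⟩
  · rintro rfl
    have := hgap c₀ hc₀ d₀ hd₀
    simp only [zero_apply] at this
    linarith
  · have : sSup (f '' C) ≤ f d - u := csSup_le ⟨_, c₀, hc₀, rfl⟩ (by
      rintro _ ⟨c, hc, rfl⟩
      linarith [hgap c hc d hd])
    linarith

/-- Mazur: closed convex sets are weakly closed. -/
theorem mem_of_tendsto_dual {ι : Type*} {l : Filter ι} [l.NeBot] {S : Set X} (hS : Convex ℝ S)
    (hcl : IsClosed S) {x : ι → X} {y : X}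
    (hx : ∀ᶠ i in l, x i ∈ S)
    (hy : ∀ f : StrongDual ℝ X, Tendsto (fun i => f (x i)) l (𝓝 (f y))) : y ∈ S := by
  by_contra hyS
  obtain ⟨f, u, hu, hfu⟩ := geometric_hahn_banach_closed_point hS hcl hyS
  exact absurd (le_of_tendsto (hy f) (hx.mono fun i hi => (hu _ hi).le)) (not_le.2 hfu)

/-! ### Interior points of the barrier cone -/

/-- A functional in the interior of the barrier cone decreases at a linear rate along `C`. -/
theorem exists_add_mul_norm_le {C : Set X} {g : StrongDual ℝ X}
    (hg : g ∈ interior (barrierCone C)) :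
    ∃ M δ : ℝ, 0 < δ ∧ ∀ c ∈ C, g c + δ * ‖c‖ ≤ M := by
  obtain ⟨M₀, hM₀⟩ := mem_barrierCone_iff.1 (interior_subset hg)
  have hpos : ∀ c ∈ C, 1 ≤ M₀ + 1 - g c := fun c hc => by linarith [hM₀ c hc]
  -- Pointwise bound for Banach–Steinhaus: `g ± t • h` stay in the barrier cone for small `t`, which
  -- controls `|h c|` by the decay of `g`.
  have key : ∀ h : StrongDual ℝ X, ∃ K, ∀ c : C, |h c| ≤ K * (M₀ + 1 - g c) := by
    intro h
    have hev : ∀ h : StrongDual ℝ X, ∀ᶠ t : ℝ in 𝓝[>] 0, g + t • h ∈ barrierCone C := by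
      intro h
      have : Tendsto (fun t : ℝ => g + t • h) (𝓝 0) (𝓝 (g + (0 : ℝ) • h)) :=
        (by fun_prop : Continuous fun t : ℝ => g + t • h).tendsto 0
      rw [zero_smul, add_zero] at this
      exact (this.mono_left nhdsWithin_le_nhds).eventually (mem_interior_iff_mem_nhds.1 hg)
    obtain ⟨t, ⟨h1, h2⟩, ht⟩ := ((hev h).and (hev (-h)) |>.and self_mem_nhdsWithin).exists
    have ht : 0 < t := ht
    obtain ⟨K₁, hK₁⟩ := mem_barrierCone_iff.1 h1
    obtain ⟨K₂, hK₂⟩ := mem_barrierCone_iff.1 h2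
    refine ⟨(|K₁| + |K₂| + |M₀ + 1| + 1) / t, fun c => ?_⟩
    have e1 := hK₁ c c.2
    have e2 := hK₂ c c.2
    simp only [add_apply, smul_apply, smul_eq_mul,
      neg_apply] at e1 e2
    have hp := hpos c c.2
    have e3 : t * |h c| ≤ (|K₁| + |K₂| + |M₀ + 1|) * 1 + (M₀ + 1 - g c) := by
      have a1 := le_abs_self K₁
      have a2 := le_abs_self K₂
      have a3 := neg_abs_le (M₀ + 1)
      have := abs_nonneg K₁
      have := abs_nonneg K₂
      rcases abs_cases (h c) with ⟨h', -⟩ | ⟨h', -⟩ <;> rw [h'] <;> linarith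
    have e4 : (|K₁| + |K₂| + |M₀ + 1|) * 1 ≤ (|K₁| + |K₂| + |M₀ + 1|) * (M₀ + 1 - g c) :=
      mul_le_mul_of_nonneg_left hp (by positivity)
    rw [div_mul_eq_mul_div, le_div_iff₀ ht]
    linarith
  obtain ⟨B, hB⟩ := banach_steinhaus
    (g := fun c : C => (M₀ + 1 - g c)⁻¹ • NormedSpace.inclusionInDoubleDual ℝ X c) (by
      intro h
      obtain ⟨K, hK⟩ := key h
      refine ⟨K, fun c => ?_⟩
      have hp : 0 < M₀ + 1 - g c := by linarith [hpos c c.2]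
      rw [smul_apply, norm_smul, norm_inv, Real.norm_of_nonneg hp.le,
        NormedSpace.dual_def, Real.norm_eq_abs, inv_mul_le_iff₀ hp, mul_comm]
      exact hK c)
  refine ⟨M₀ + 1, (|B| + 1)⁻¹, by positivity, fun c hc => ?_⟩
  have hp : 0 < M₀ + 1 - g c := by linarith [hpos c hc]
  have h1 := hB ⟨c, hc⟩
  have h2 : ‖NormedSpace.inclusionInDoubleDual ℝ X c‖ = ‖c‖ :=
    (NormedSpace.inclusionInDoubleDualLi ℝ (E := X)).norm_map c
  rw [norm_smul, norm_inv, Real.norm_of_nonneg hp.le, h2, inv_mul_le_iff₀ hp] at h1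
  have h3 : ‖c‖ ≤ (|B| + 1) * (M₀ + 1 - g c) := by nlinarith [le_abs_self B]
  have h4 : (|B| + 1)⁻¹ * ‖c‖ ≤ M₀ + 1 - g c := by
    rwa [inv_mul_le_iff₀ (by positivity)]
  linarith

/-- If a functional has a bounded slice, it lies in the interior of the barrier cone. -/
theorem mem_interior_barrierCone_of_bounded {C : Set X} (hC : Convex ℝ C) {f : StrongDual ℝ X}
    (hf : f ∈ barrierCone C) {c₀ : X} (hc₀ : c₀ ∈ C)
    (hb : Bornology.IsBounded (C ∩ {x | f c₀ - 1 ≤ f x})) : f ∈ interior (barrierCone C) := by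
  obtain ⟨M, hM⟩ := mem_barrierCone_iff.1 hf
  obtain ⟨R, hR0, hR⟩ := hb.subset_ball_lt 0 c₀
  have hslope : ∀ c ∈ C, ‖c - c₀‖ ≤ R * (1 + |M| + |f c₀| + (M - f c)) := by
    intro c hc
    have hMc := hM c hc
    have hx : 1 ≤ 1 + |M| + |f c₀| + (M - f c) := by
      have := abs_nonneg M
      have := abs_nonneg (f c₀)
      linarith
    by_cases h : f c₀ - 1 ≤ f c
    · have := hR ⟨hc, h⟩
      rw [Metric.mem_ball, dist_eq_norm] at this
      nlinarith
    · rw [not_le] at h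
      set T := f c₀ - f c with hT
      have hT1 : 1 < T := by linarith
      -- Pulling `c` back towards `c₀` to the level `f c₀ - 1` lands in the bounded slice, hence `‖c
      -- - c₀‖ < R * T`.
      have hmem : c₀ + T⁻¹ • (c - c₀) ∈ C := by
        have := hC hc₀ hc (a := 1 - T⁻¹) (b := T⁻¹)
          (by linarith [inv_le_one_of_one_le₀ hT1.le]) (by positivity) (by ring)
        convert this using 1
        module
      have := hR ⟨hmem, by
        have : T⁻¹ * T = 1 := inv_mul_cancel₀ (by linarith)
        simp only [Set.mem_ofPred_eq, map_add, map_smul, map_sub, smul_eq_mul]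
        rw [show f c - f c₀ = -T by ring]
        linarith⟩
      rw [Metric.mem_ball, dist_eq_norm, add_sub_cancel_left, norm_smul, norm_inv,
        Real.norm_of_nonneg (by linarith), inv_mul_lt_iff₀ (by linarith)] at this
      have h5 : T ≤ 1 + |M| + |f c₀| + (M - f c) := by
        have := neg_abs_le M
        have := le_abs_self (f c₀)
        linarith
      nlinarith
  rw [mem_interior_iff_mem_nhds, Metric.mem_nhds_iff]
  refine ⟨R⁻¹, by positivity, fun g hg => mem_barrierCone_iff.2
    ⟨1 + |M| + |f c₀| + M + R⁻¹ * ‖c₀‖, fun c hc => ?_⟩⟩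
  rw [Metric.mem_ball, dist_eq_norm] at hg
  have h1 : g c - f c ≤ ‖g - f‖ * ‖c‖ := (le_abs_self _).trans ((g - f).le_opNorm c)
  have h2 : ‖c‖ ≤ ‖c - c₀‖ + ‖c₀‖ := by simpa using norm_add_le (c - c₀) c₀
  have h3 : ‖g - f‖ * ‖c‖ ≤ R⁻¹ * (‖c - c₀‖ + ‖c₀‖) := by gcongr
  have h4 : R⁻¹ * ‖c - c₀‖ ≤ 1 + |M| + |f c₀| + (M - f c) := by
    rw [inv_mul_le_iff₀ hR0]
    exact hslope c hc
  linarith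

/-! ### Disjoint sets asymptotic to `C` -/

theorem convex_hyperbola : Convex ℝ {p : ℝ × ℝ | 0 ≤ p.1 ∧ 0 ≤ p.2 ∧ 1 ≤ p.1 * p.2} := by
  rintro ⟨a, b⟩ ⟨ha, hb, hab⟩ ⟨c, d⟩ ⟨hc, hd, hcd⟩ s t hs ht hst
  simp only at ha hb hab hc hd hcd
  simp only [Set.mem_ofPred_eq, Prod.smul_mk, Prod.mk_add_mk, smul_eq_mul]
  refine ⟨by positivity, by positivity, ?_⟩
  -- AM–GM for the cross term: the product of the two summands is at least `1`.
  have h1 : 2 ≤ a * d + b * c := by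
    have h2 : 1 ≤ (a * d) * (b * c) := by nlinarith [mul_le_mul hab hcd zero_le_one (by positivity)]
    have h3 : 0 ≤ a * d := by positivity
    have h4 : 0 ≤ b * c := by positivity
    nlinarith [sq_nonneg (a * d - b * c)]
  obtain rfl : s = 1 - t := by linarith
  nlinarith [mul_nonneg hs ht, mul_nonneg hs hs, mul_nonneg ht ht,
    mul_le_mul_of_nonneg_left h1 (mul_nonneg hs ht),
    mul_le_mul_of_nonneg_left hab (mul_nonneg hs hs),
    mul_le_mul_of_nonneg_left hcd (mul_nonneg ht ht)]

/-- A ray of `C` along which some direction immediately leaves `C` yields a disjoint closed convex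
set asymptotic to `C`. -/
theorem not_hasStrongSeparationProperty_of_ray {C : Set X} {c₀ u v : X}
    (hu : ∀ s : ℝ, 0 ≤ s → c₀ + s • u ∈ C)
    (hv : ∀ s t : ℝ, 0 ≤ s → 0 < t → c₀ + s • u + t • v ∉ C) (hu0 : u ≠ 0) :
    ¬ HasStrongSeparationProperty C := by
  intro hC
  let L : ℝ × ℝ →ₗ[ℝ] X :=
    (LinearMap.toSpanSingleton ℝ X u).coprod (LinearMap.toSpanSingleton ℝ X v)
  have hL : ∀ p, L p = p.1 • u + p.2 • v := fun p => by simp [L]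
  have hker : LinearMap.ker L = ⊥ := by
    rw [LinearMap.ker_eq_bot']
    rintro ⟨a, b⟩ hab
    rw [hL] at hab
    simp only at hab
    -- If `v` were a multiple of `u`, then `c₀ + s • u + v` would lie on the ray for large `s`,
    -- against `hv`.
    have hb : b = 0 := by
      by_contra hb
      have hvu : v = (-(a / b)) • u := by
        have : b • v = (-a) • u := by rw [neg_smul]; exact eq_neg_of_add_eq_zero_right hab
        rw [← inv_smul_smul₀ hb v, this, smul_smul]
        congr 1
        field_simp
      refine hv |a / b| 1 (abs_nonneg _) one_pos ?_
      have := hu (|a / b| - a / b) (by linarith [le_abs_self (a / b)])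
      convert this using 1
      rw [hvu]
      module
    subst hb
    simpa [hu0] using hab
  have hLc := LinearMap.isClosedEmbedding_of_injective hker
  let P : Set (ℝ × ℝ) := {p | 0 ≤ p.1 ∧ 0 ≤ p.2 ∧ 1 ≤ p.1 * p.2}
  have hP : IsClosed P :=
    (isClosed_le continuous_const continuous_fst).inter
      ((isClosed_le continuous_const continuous_snd).inter
        (isClosed_le continuous_const (continuous_fst.mul continuous_snd)))
  let D : Set X := (fun x => c₀ + x) '' (L '' P)
  have hmem : ∀ s : ℝ, 0 < s → c₀ + (s • u + s⁻¹ • v) ∈ D := fun s hs =>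
    ⟨_, ⟨(s, s⁻¹), ⟨hs.le, (inv_pos.2 hs).le, (mul_inv_cancel₀ hs.ne').ge⟩, rfl⟩, by simp [hL]⟩
  obtain ⟨ε, hε, h⟩ := (hC D ⟨_, hmem 1 one_pos⟩
    ((Homeomorph.addLeft c₀).isClosedMap _ (hLc.isClosedMap _ hP))
    ((convex_hyperbola.linear_image L).translate c₀) (by
      rw [Set.disjoint_right]
      rintro _ ⟨_, ⟨⟨s, t⟩, ⟨hs, ht, hst⟩, rfl⟩, rfl⟩ hx
      simp only at hs ht hst
      refine hv s t hs (lt_of_le_of_ne ht ?_) (by rwa [add_assoc, ← hL (s, t)])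
      rintro rfl
      simp at hst
      linarith)).exists_pos_le_norm_sub
  set s := (‖v‖ + 1) / ε with hs
  have hs0 : 0 < s := by positivity
  have h1 := h _ (hu s hs0.le) _ (hmem s hs0)
  rw [show c₀ + (s • u + s⁻¹ • v) - (c₀ + s • u) = s⁻¹ • v by abel, norm_smul, norm_inv,
    Real.norm_of_nonneg hs0.le, ← div_eq_inv_mul, le_div_iff₀ hs0, hs,
    mul_div_cancel₀ _ hε.ne'] at h1
  linarith

/-- Under the strong separation property a functional bounded above on `C` attains its maximum. -/
theorem HasStrongSeparationProperty.exists_isMaxOn {C : Set X}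
    (h : HasStrongSeparationProperty C) (hne : C.Nonempty) {f : StrongDual ℝ X}
    (hf : f ∈ barrierCone C) (hf0 : f ≠ 0) : ∃ c₀ ∈ C, ∀ c ∈ C, f c ≤ f c₀ := by
  obtain ⟨M, hM⟩ := mem_barrierCone_iff.1 hf
  have hbdd : BddAbove (f '' C) := ⟨M, by rintro _ ⟨c, hc, rfl⟩; exact hM c hc⟩
  obtain ⟨v, hv⟩ : ∃ v, f v = 1 := by
    obtain ⟨w, hw⟩ := DFunLike.ne_iff.1 hf0
    exact ⟨(f w)⁻¹ • w, by rw [map_smul, smul_eq_mul, inv_mul_cancel₀ hw]⟩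
  set σ := sSup (f '' C) with hσ
  have hle : ∀ c ∈ C, f c ≤ σ := fun c hc => le_csSup hbdd ⟨c, hc, rfl⟩
  by_contra! hcon
  have hlt : ∀ c ∈ C, f c < σ := fun c hc => by
    obtain ⟨c', hc', hlt⟩ := hcon c hc
    exact hlt.trans_le (hle c' hc')
  obtain ⟨ε, hε, hsep⟩ := (h {x | f x = σ} ⟨σ • v, by simp [hv]⟩
    (isClosed_eq f.continuous continuous_const)
    (convex_hyperplane f.toLinearMap.isLinear σ)
    (Set.disjoint_left.2 fun c hc hc' => (hlt c hc).ne hc')).exists_pos_le_norm_sub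
  obtain ⟨_, ⟨c, hc, rfl⟩, hcσ⟩ := exists_lt_of_lt_csSup (hne.image f)
    (show σ - ε / (‖v‖ + 1) < σ by
      have : 0 < ε / (‖v‖ + 1) := by positivity
      linarith)
  have h1 := hsep c hc (c + (σ - f c) • v) (by simp [hv])
  rw [add_sub_cancel_left, norm_smul, Real.norm_of_nonneg (by linarith [hle c hc])] at h1
  have h2 : σ - f c < ε / (‖v‖ + 1) := by linarith
  rw [lt_div_iff₀ (by positivity)] at h2
  nlinarith [hlt c hc]

/-- A closed convex set with empty interior that recedes in a nonzero direction does not have the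
strong separation property. -/
theorem HasStrongSeparationProperty.interior_nonempty [CompleteSpace X] {C : Set X}
    (h : HasStrongSeparationProperty C) (hcl : IsClosed C) (hC : Convex ℝ C) (hne : C.Nonempty)
    {u : X} (hu0 : u ≠ 0) (hu : ∀ x ∈ C, ∀ s : ℝ, 0 ≤ s → x + s • u ∈ C) :
    (interior C).Nonempty := by
  by_contra hint
  rw [Set.not_nonempty_iff_eq_empty] at hint
  obtain ⟨c₀, hc₀⟩ := hne
  -- If every `v` had some `φ n v ∈ C`, the closed preimages of `C` would cover `X`, and by Baire
  -- one would have interior; `φ n` is open, so `C` would too.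
  let φ : ℕ → X → X := fun n w => c₀ + (n : ℝ) • u + ((n : ℝ) + 1)⁻¹ • w
  have hφ : ∀ n : ℕ, Continuous (φ n) := fun n => by fun_prop
  have hφo : ∀ n : ℕ, IsOpenMap (φ n) := fun n =>
    (isOpenMap_add_left (c₀ + (n : ℝ) • u)).comp
      (isOpenMap_smul₀ (inv_ne_zero (by positivity : ((n : ℝ) + 1) ≠ 0)))
  obtain ⟨v, hv⟩ : ∃ v, ∀ n, φ n v ∉ C := by
    by_contra! hcov
    obtain ⟨n, w, hw⟩ := nonempty_interior_of_iUnion_of_closed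
      (fun n => hcl.preimage (hφ n))
      (Set.eq_univ_of_forall fun v => Set.mem_iUnion.2 (hcov v))
    have : φ n w ∈ interior C :=
      interior_maximal (Set.image_subset_iff.2 interior_subset)
        (hφo n _ isOpen_interior) ⟨w, hw, rfl⟩
    rw [hint] at this
    exact this
  refine not_hasStrongSeparationProperty_of_ray (v := v) (hu c₀ hc₀)
    (fun s t hs ht hmem => ?_) hu0 h
  obtain ⟨n, hn⟩ := exists_nat_ge (s + t⁻¹)
  have ht' : 0 < t⁻¹ := inv_pos.2 ht
  refine hv n ?_
  have h1 : c₀ + (n : ℝ) • u + t • v ∈ C := by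
    convert hu _ hmem (n - s) (by linarith) using 1
    module
  have h2 : c₀ + (n : ℝ) • u ∈ C := hu c₀ hc₀ n n.cast_nonneg
  -- This is the weight that places `φ n v` on the segment from `c₀ + n • u` to `c₀ + n • u + t •
  -- v`.
  have hq : ((n : ℝ) + 1)⁻¹ * t⁻¹ ≤ 1 := by
    rw [inv_mul_le_iff₀ (by positivity)]
    linarith
  have h3 := hC h2 h1 (a := 1 - ((n : ℝ) + 1)⁻¹ * t⁻¹) (b := ((n : ℝ) + 1)⁻¹ * t⁻¹)
    (by linarith) (by positivity) (by ring)
  convert h3 using 1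
  have h4 : (((n : ℝ) + 1)⁻¹ * t⁻¹) • t • v = ((n : ℝ) + 1)⁻¹ • v := by
    rw [smul_smul, mul_assoc, inv_mul_cancel₀ ht.ne', mul_one]
  rw [smul_add _ _ (t • v), h4]
  simp only [φ]
  module

/-! ### Recession directions from weak limits -/

/-- Weak limits of normalised unbounded sequences in a closed convex set are recession
directions. -/
theorem add_smul_mem_of_tendsto_dual {l : Filter ℕ} [l.NeBot] {S : Set X} (hS : Convex ℝ S)
    (hcl : IsClosed S) {x : ℕ → X} (hxS : ∀ n, x n ∈ S) (hx : Tendsto (fun n => ‖x n‖) l atTop)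
    {u : X} (hu : ∀ f : StrongDual ℝ X, Tendsto (fun n => f (‖x n‖⁻¹ • x n)) l (𝓝 (f u)))
    {y : X} (hy : y ∈ S) {s : ℝ} (hs : 0 ≤ s) : y + s • u ∈ S := by
  have ht : Tendsto (fun n => s * ‖x n‖⁻¹) l (𝓝 0) := by
    simpa using (tendsto_inv_atTop_zero.comp hx).const_mul s
  -- Convex combinations giving `x n` the weight `s / ‖x n‖` converge weakly to `y + s • u`.
  refine mem_of_tendsto_dual (l := l) hS hcl
    (x := fun n => (1 - s * ‖x n‖⁻¹) • y + (s * ‖x n‖⁻¹) • x n) ?_ fun f => ?_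
  · filter_upwards [ht.eventually (ge_mem_nhds one_pos)] with n hn
    exact hS hy (hxS n) (by linarith) (by positivity) (by ring)
  · have h1 : Tendsto (fun n => (1 - s * ‖x n‖⁻¹) * f y + s * f (‖x n‖⁻¹ • x n)) l
        (𝓝 ((1 - 0) * f y + s * f u)) :=
      ((tendsto_const_nhds.sub ht).mul_const _).add ((hu f).const_mul s)
    simpa [mul_assoc] using h1

/-- Normalisation kills the part in the ball, and the part in `Z` is compact, so the limit is even
in norm and has norm `1`. -/
theorem ConditionC.exists_tendsto_normalized {C : Set X} (h : ConditionC C)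
    (l : Ultrafilter ℕ) {x : ℕ → X} (hxC : ∀ n, x n ∈ C)
    (hx : Tendsto (fun n => ‖x n‖) l atTop) :
    ∃ u : X, u ≠ 0 ∧
      ∀ f : StrongDual ℝ X, Tendsto (fun n => f (‖x n‖⁻¹ • x n)) l (𝓝 (f u)) := by
  obtain ⟨r, hr, Z, hZ, hCZ⟩ := h
  have : ∀ n, ∃ z : Z, ‖x n - z‖ < r := fun n => by
    obtain ⟨b, hb, z, hz, hbz⟩ := Set.mem_add.1 (hCZ (hxC n))
    refine ⟨⟨z, hz⟩, ?_⟩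
    rw [← hbz, add_sub_cancel_right]
    simpa using hb
  choose z hz using this
  have hinv : Tendsto (fun n => ‖x n‖⁻¹) l (𝓝 0) := tendsto_inv_atTop_zero.comp hx
  have hball : ∀ᶠ n in (l : Filter ℕ), ‖x n‖⁻¹ • z n ∈ Metric.closedBall (0 : Z) (1 + r) := by
    filter_upwards [hx.eventually_ge_atTop 1] with n hn
    rw [mem_closedBall_zero_iff, norm_smul, norm_inv, norm_norm,
      inv_mul_le_iff₀ (by linarith)]
    have h1 : ‖(z n : X)‖ ≤ ‖x n‖ + ‖x n - z n‖ := by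
      simpa using norm_sub_le (x n) (x n - z n)
    have h2 : ‖z n‖ ≤ ‖x n‖ + ‖x n - z n‖ := h1
    nlinarith [hz n]
  have : ProperSpace Z := FiniteDimensional.proper ℝ Z
  obtain ⟨w, -, hw⟩ := (isCompact_closedBall (0 : Z) (1 + r)).ultrafilter_le_nhds
    (l.map fun n => ‖x n‖⁻¹ • z n) (le_principal_iff.2 hball)
  have hw : Tendsto (fun n => ‖x n‖⁻¹ • z n) l (𝓝 w) := hw
  have hlim : Tendsto (fun n => ‖x n‖⁻¹ • x n) l (𝓝 (w : X)) := by
    have h1 : Tendsto (fun n => ((‖x n‖⁻¹ • z n : Z) : X)) l (𝓝 (w : X)) :=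
      (continuous_subtype_val.tendsto w).comp hw
    have h2 : Tendsto (fun n => ‖x n‖⁻¹ • (x n - z n)) l (𝓝 0) := by
      refine squeeze_zero_norm (a := fun n => ‖x n‖⁻¹ * r) (fun n => ?_) ?_
      · rw [norm_smul, norm_inv, norm_norm]
        exact mul_le_mul_of_nonneg_left (hz n).le (by positivity)
      · simpa using hinv.mul_const r
    have h3 := h1.add h2
    rw [add_zero] at h3
    refine h3.congr fun n => ?_
    rw [Z.coe_smul]
    module
  refine ⟨w, ?_, fun f => (f.continuous.tendsto _).comp hlim⟩
  have hnorm : ‖(w : X)‖ = 1 := by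
    refine tendsto_nhds_unique hlim.norm (tendsto_const_nhds.congr' ?_)
    filter_upwards [hx.eventually_gt_atTop 0] with n hn
    rw [norm_smul, norm_inv, norm_norm, inv_mul_cancel₀ hn.ne']
  rw [← norm_pos_iff, hnorm]
  exact one_pos

end Normed

section Hilbert

variable {X : Type*} [NormedAddCommGroup X] [InnerProductSpace ℝ X] [CompleteSpace X]

/-- Banach–Alaoglu transported by the Riesz isomorphism; the ultrafilter replaces passing to a
subsequence. -/
theorem exists_tendsto_dual_of_bounded {ι : Type*} (l : Ultrafilter ι) {x : ι → X} {R : ℝ}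
    (hx : ∀ᶠ i in (l : Filter ι), ‖x i‖ ≤ R) :
    ∃ y : X, ∀ f : StrongDual ℝ X, Tendsto (fun i => f (x i)) l (𝓝 (f y)) := by
  let J := InnerProductSpace.toDual ℝ X
  obtain ⟨φ, -, hφ⟩ := (WeakDual.isCompact_closedBall (𝕜 := ℝ) (0 : StrongDual ℝ X)
    R).ultrafilter_le_nhds (l.map fun i => StrongDual.toWeakDual (J (x i)))
    (le_principal_iff.2 (by
      rw [Ultrafilter.coe_map, mem_map]
      filter_upwards [hx] with i hi
      simpa using hi))
  have hφ : Tendsto (fun i => StrongDual.toWeakDual (J (x i))) l (𝓝 φ) := hφ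
  refine ⟨J.symm (WeakDual.toStrongDual φ), fun f => ?_⟩
  have h1 := ((WeakDual.eval_continuous (J.symm f)).tendsto φ).comp hφ
  have h2 : ∀ y : X, f y = inner ℝ y (J.symm f) := fun y => by
    rw [real_inner_comm, InnerProductSpace.toDual_symm_apply]
  simp only [h2]
  have h3 : inner ℝ (J.symm (WeakDual.toStrongDual φ)) (J.symm f) = φ (J.symm f) :=
    InnerProductSpace.toDual_symm_apply
  rw [h3]
  exact h1

/-- Under (A), the linear decay of an interior `g` forces `g u ≤ -δ`, so `u ≠ 0`. -/
theorem exists_tendsto_normalized {C : Set X} (h : ConditionA C ∨ ConditionC C)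
    (l : Ultrafilter ℕ) {x : ℕ → X} (hxC : ∀ n, x n ∈ C)
    (hx : Tendsto (fun n => ‖x n‖) l atTop) :
    ∃ u : X, u ≠ 0 ∧
      ∀ f : StrongDual ℝ X, Tendsto (fun n => f (‖x n‖⁻¹ • x n)) l (𝓝 (f u)) := by
  rcases h with ⟨-, g, hg⟩ | h
  · obtain ⟨M, δ, hδ, hM⟩ := exists_add_mul_norm_le hg
    obtain ⟨u, hu⟩ := exists_tendsto_dual_of_bounded l (x := fun n => ‖x n‖⁻¹ • x n) (R := 1)
      (.of_forall fun n => by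
        rw [norm_smul, norm_inv, norm_norm]
        exact inv_mul_le_one)
    refine ⟨u, ?_, hu⟩
    have hinv : Tendsto (fun n => M * ‖x n‖⁻¹ - δ) l (𝓝 (M * 0 - δ)) :=
      ((tendsto_inv_atTop_zero.comp hx).const_mul M).sub_const δ
    have hle : g u ≤ M * 0 - δ := by
      refine le_of_tendsto_of_tendsto (hu g) hinv ?_
      filter_upwards [hx.eventually_gt_atTop 0] with n hn
      have h1 := mul_le_mul_of_nonneg_left (hM _ (hxC n)) (inv_pos.2 hn).le
      rw [mul_add, mul_left_comm, inv_mul_cancel₀ hn.ne'] at h1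
      rw [map_smul, smul_eq_mul]
      linarith
    rintro rfl
    rw [map_zero] at hle
    linarith
  · exact h.exists_tendsto_normalized l hxC hx

theorem exists_recession_direction {C S : Set X} (h : ConditionA C ∨ ConditionC C)
    (hSC : S ⊆ C) (hS : Convex ℝ S) (hcl : IsClosed S) (hb : ¬ Bornology.IsBounded S) :
    ∃ u : X, u ≠ 0 ∧ ∀ y ∈ S, ∀ s : ℝ, 0 ≤ s → y + s • u ∈ S := by
  obtain ⟨x, hxS, hx⟩ := exists_seq_tendsto_norm_of_not_isBounded hb
  have hx' : Tendsto (fun n => ‖x n‖) (hyperfilter ℕ : Filter ℕ) atTop :=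
    hx.mono_left Nat.hyperfilter_le_atTop
  obtain ⟨u, hu0, hu⟩ := exists_tendsto_normalized h (hyperfilter ℕ) (fun n => hSC (hxS n)) hx'
  exact ⟨u, hu0, fun y hy s hs => add_smul_mem_of_tendsto_dual hS hcl hxS hx' hu hy hs⟩

/-! ### The barrier cone criterion, in both directions -/

theorem HasStrongSeparationProperty.mem_interior_barrierCone {C : Set X}
    (h : HasStrongSeparationProperty C) (hne : C.Nonempty) (hcl : IsClosed C) (hC : Convex ℝ C)
    (hAC : ConditionA C ∨ ConditionC C) {f : StrongDual ℝ X} (hf : f ∈ barrierCone C)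
    (hf0 : f ≠ 0) : f ∈ interior (barrierCone C) := by
  obtain ⟨c₀, hc₀, hmax⟩ := h.exists_isMaxOn hne hf hf0
  refine mem_interior_barrierCone_of_bounded hC hf hc₀ ?_
  by_contra hb
  obtain ⟨u, hu0, hu⟩ := exists_recession_direction hAC Set.inter_subset_left
    (hC.inter (convex_halfSpace_ge f.toLinearMap.isLinear (f c₀ - 1)))
    (hcl.inter (isClosed_le continuous_const f.continuous)) hb
  have hray : ∀ s : ℝ, 0 ≤ s → c₀ + s • u ∈ C ∩ {x | f c₀ - 1 ≤ f x} := fun s hs =>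
    hu c₀ ⟨hc₀, by simp⟩ s hs
  -- Maximality gives `f u ≤ 0`; if it were negative, moving by `2 / -f u` would lower `f` by `2`
  -- and leave the slice.
  have hfu : f u = 0 := by
    have h1 := hmax _ (hray 1 zero_le_one).1
    rw [one_smul, map_add] at h1
    by_contra hne0
    have hneg : f u < 0 := lt_of_le_of_ne (by linarith) hne0
    have h2 : f c₀ - 1 ≤ f (c₀ + (2 / -f u) • u) := (hray (2 / -f u)
      (div_nonneg zero_le_two (by linarith))).2
    rw [map_add, map_smul, smul_eq_mul, div_neg, neg_mul, div_mul_cancel₀ _ hne0] at h2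
    linarith
  obtain ⟨v, hv⟩ : ∃ v, f v = 1 := by
    obtain ⟨w, hw⟩ := DFunLike.ne_iff.1 hf0
    exact ⟨(f w)⁻¹ • w, by rw [map_smul, smul_eq_mul, inv_mul_cancel₀ hw]⟩
  refine not_hasStrongSeparationProperty_of_ray (fun s hs => (hray s hs).1)
    (fun s t _ ht hmem => ?_) hu0 h (v := v)
  have := hmax _ hmem
  simp only [map_add, map_smul, hfu, hv, smul_eq_mul, mul_zero, mul_one, add_zero] at this
  linarith

theorem exists_pos_le_norm_sub_of_mem_interior_barrierCone {C D : Set X} (hC : Convex ℝ C)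
    (hCcl : IsClosed C) (hD : Convex ℝ D) (hDcl : IsClosed D) (hdisj : Disjoint C D)
    {f : StrongDual ℝ X} (hf : f ∈ interior (barrierCone C)) {α : ℝ} (hfD : ∀ d ∈ D, α ≤ f d) :
    ∃ ε > 0, ∀ c ∈ C, ∀ d ∈ D, ε ≤ ‖d - c‖ := by
  by_contra! hcon
  choose c hc d hd hcd using fun n : ℕ =>
    hcon (1 / ((n : ℝ) + 1)) Nat.one_div_pos_of_nat
  obtain ⟨M, δ, hδ, hM⟩ := exists_add_mul_norm_le hf
  have hbd : ∀ n, ‖c n‖ ≤ (M - α + ‖f‖) / δ := fun n => by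
    have h1 : f (d n) - f (c n) ≤ ‖f‖ * ‖d n - c n‖ := by
      rw [← map_sub]
      exact (le_abs_self _).trans (f.le_opNorm _)
    have h2 : ‖d n - c n‖ ≤ 1 := (hcd n).le.trans (by
      rw [div_le_one (by positivity)]
      linarith [n.cast_nonneg (α := ℝ)])
    have h3 := mul_le_mul_of_nonneg_left h2 (norm_nonneg f)
    rw [le_div_iff₀ hδ]
    linarith [hM _ (hc n), hfD _ (hd n)]
  obtain ⟨y, hy⟩ := exists_tendsto_dual_of_bounded (hyperfilter ℕ) (.of_forall hbd)
  have hsub : Tendsto (fun n => d n - c n) (hyperfilter ℕ : Filter ℕ) (𝓝 0) :=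
    (squeeze_zero_norm (fun n => (hcd n).le) tendsto_one_div_add_atTop_nhds_zero_nat).mono_left
      Nat.hyperfilter_le_atTop
  refine Set.disjoint_left.1 hdisj (mem_of_tendsto_dual hC hCcl (.of_forall hc) hy)
    (mem_of_tendsto_dual (l := (hyperfilter ℕ : Filter ℕ)) hD hDcl (.of_forall hd) fun g => ?_)
  have h1 := (hy g).add ((g.continuous.tendsto 0).comp hsub)
  simpa using h1

theorem hasStrongSeparationProperty_of_barrierCone {C : Set X} (hC : Convex ℝ C)
    (hcl : IsClosed C) (hint : (interior C).Nonempty)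
    (hbar : ∀ f ∈ barrierCone C, f ≠ 0 → f ∈ interior (barrierCone C)) :
    HasStrongSeparationProperty C := by
  intro D hDne hDcl hD hdisj
  obtain ⟨f, α, hfC, hfD⟩ := geometric_hahn_banach_open hC.interior isOpen_interior hD
    (hdisj.mono_left interior_subset)
  have hle : ∀ c ∈ C, f c ≤ α := by
    -- The bound passes from the interior to `C`, which lies in the closure of its nonempty
    -- interior.
    have h1 : closure (interior C) ⊆ {x | f x ≤ α} :=
      closure_minimal (fun x hx => (hfC x hx).le) (isClosed_le f.continuous continuous_const)
    rw [hC.closure_interior_eq_closure_of_nonempty_interior hint] at h1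
    exact fun c hc => h1 (subset_closure hc)
  have hf0 : f ≠ 0 := by
    rintro rfl
    obtain ⟨a, ha⟩ := hint
    obtain ⟨b, hb⟩ := hDne
    exact absurd ((hfC a ha).trans_le (hfD b hb)) (lt_irrefl 0)
  obtain ⟨ε, hε, h⟩ := exists_pos_le_norm_sub_of_mem_interior_barrierCone hC hcl hD hDcl hdisj
    (hbar f (mem_barrierCone_iff.2 ⟨α, hle⟩) hf0) hfD
  exact stronglySeparated_of_pos_le_norm_sub hC hD (hint.mono interior_subset) hDne hε h

end Hilbert

end BarrierSeparation

theorem mainTheorem5 {X : Type*} [NormedAddCommGroup X] [InnerProductSpace ℝ X] [CompleteSpace X]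
    (C : Set X) (hunbounded : ¬ Bornology.IsBounded C) (hclosed : IsClosed C)
    (hconvex : Convex ℝ C)
    (hAC : BarrierSeparation.ConditionA C ∨ BarrierSeparation.ConditionC C) :
    BarrierSeparation.HasStrongSeparationProperty C ↔
      (interior C).Nonempty ∧
        BarrierSeparation.barrierCone C =
          interior (BarrierSeparation.barrierCone C) ∪ {0} := by
  have hne : C.Nonempty := by
    by_contra hne
    rw [Set.not_nonempty_iff_eq_empty] at hne
    exact hunbounded (hne ▸ Bornology.isBounded_empty)
  constructor
  · intro h
    obtain ⟨u, hu0, hu⟩ := BarrierSeparation.exists_recession_direction hAC subset_rfl hconvex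
      hclosed hunbounded
    refine ⟨h.interior_nonempty hclosed hconvex hne hu0 hu, Set.Subset.antisymm ?_ ?_⟩
    · intro f hf
      by_cases hf0 : f = 0
      · exact Or.inr hf0
      · exact Or.inl (h.mem_interior_barrierCone hne hclosed hconvex hAC hf hf0)
    · rintro f (hf | rfl)
      · exact interior_subset hf
      · exact BarrierSeparation.zero_mem_barrierCone C
  · rintro ⟨hint, hbar⟩
    refine BarrierSeparation.hasStrongSeparationProperty_of_barrierCone hconvex hclosed hint
      fun f hf hf0 => ?_
    rw [hbar] at hf
    exact hf.resolve_right hf0
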